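/- Let $G$ be a finite group and let $f\in Z^2(G,\mathbb{C}^*)$ be a $2$-cocycle for the trivial action of $G$ on $\mathbb{C}^*$. Let $\mathbb{C}^fG$ be the twisted group algebra, i.e. the associative $\mathbb{C}$-algebra with basis $\{u_g\}_{g\in G}$ and multiplication $u_xu_y=f(x,y)u_{xy}$. Call $f$ nondegenerate if $\mathbb{C}^fG$ is a simple algebra (and similarly for cocycles on subgroups of $G$). Let $G$ act on $\mathbb{C}^fG$ by $g(a)=u_g a u_g^{-1}$; a nonzero $a\in\mathbb{C}^fG$ is semi-invariant if there is $\lambda\in\mathrm{Hom}(G,\mathbb{C}^*)$ with $g(a)=\lambda(g)a$ for all $g\in G$, and the semi-center $\mathrm{Sz}(\mathbb{C}^fG)$ is the subalgebra of $\mathbb{C}^fG$ spanned by all semi-invariant elements. Theorem 3. Let $\mathbb{C}^fG$ be a simple twisted group algebra, and let $G'$ be the commutator subgroup of $G$. If the restriction of $f$ to $G'$ is also nondegenerate, then $\mathrm{Sz}(\mathbb{C}^fG)$ is simple. In particular, if $G'$ is a Hall subgroup of $G$ (i.e. $|G'|$ and $[G:G']$ are coprime), then $\mathrm{Sz}(\mathbb{C}^fG)$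 is simple. -/

import Mathlib

/-- A 2-cocycle `f ∈ Z²(G, ℂˣ)` for the trivial action of the group `G` on `ℂˣ`
(not assumed to be normalized). -/
structure TwoCocycle (G : Type*) [Group G] where
  /-- The underlying function of two variables. -/
  toFun : G → G → ℂˣ
  cocycle : ∀ x y z : G,
    toFun x y * toFun (x * y) z = toFun y z * toFun x (y * z)

namespace TwoCocycle

variable {G : Type*} [Group G]

instance : CoeFun (TwoCocycle G) (fun _ => G → G → ℂˣ) := ⟨TwoCocycle.toFun⟩

/-- The restriction of a 2-cocycle to a subgroup. -/
def restrict (f : TwoCocycle G) (H : Subgroup G) : TwoCocycle H where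
  toFun x y := f x y
  cocycle x y z := f.cocycle x y z

theorem one_left (f : TwoCocycle G) (z : G) : f 1 z = f 1 1 := by
  have h := f.cocycle 1 1 z
  simp only [one_mul] at h
  exact (mul_right_cancel h).symm

theorem one_right (f : TwoCocycle G) (x : G) : f x 1 = f 1 1 := by
  have h := f.cocycle x 1 1
  simp only [mul_one] at h
  exact mul_right_cancel h

end TwoCocycle

/-- The twisted group algebra `ℂ^f G`: the complex vector space with basis `u_g` (`g ∈ G`),
with multiplication determined by `u_x u_y = f(x,y) u_{xy}`. -/
def TwistedGroupAlgebra {G : Type*} [Group G] (_f : TwoCocycle G) : Type _ := G →₀ ℂ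

namespace TwistedGroupAlgebra

variable {G : Type*} [Group G] (f : TwoCocycle G)

noncomputable instance : AddCommGroup (TwistedGroupAlgebra f) :=
  inferInstanceAs (AddCommGroup (G →₀ ℂ))

noncomputable instance : Module ℂ (TwistedGroupAlgebra f) :=
  inferInstanceAs (Module ℂ (G →₀ ℂ))

/-- The basis `u_g`, `g ∈ G`. -/
noncomputable def basis : Module.Basis G ℂ (TwistedGroupAlgebra f) :=
  (Finsupp.basisSingleOne : Module.Basis G ℂ (G →₀ ℂ))

/-- The bilinear multiplication, given on basis elements by `u_x u_y = f(x,y) u_{xy}`. -/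
noncomputable def mulBilin :
    TwistedGroupAlgebra f →ₗ[ℂ] TwistedGroupAlgebra f →ₗ[ℂ] TwistedGroupAlgebra f :=
  (basis f).constr ℂ fun x => (basis f).constr ℂ fun y => ((f x y : ℂˣ) : ℂ) • basis f (x * y)

noncomputable instance : Mul (TwistedGroupAlgebra f) := ⟨fun a b => mulBilin f a b⟩

/-- The unit element is `f(1,1)⁻¹ u_1`. -/
noncomputable instance : One (TwistedGroupAlgebra f) := ⟨((f 1 1 : ℂˣ) : ℂ)⁻¹ • basis f 1⟩

theorem mul_def (a b : TwistedGroupAlgebra f) : a * b = mulBilin f a b := rfl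

theorem one_def : (1 : TwistedGroupAlgebra f) = ((f 1 1 : ℂˣ) : ℂ)⁻¹ • basis f 1 := rfl

theorem basis_mul_basis (x y : G) :
    basis f x * basis f y = ((f x y : ℂˣ) : ℂ) • basis f (x * y) := by
  simp [mul_def, mulBilin]

theorem smul_mul' (c : ℂ) (a b : TwistedGroupAlgebra f) : (c • a) * b = c • (a * b) := by
  simp [mul_def]

theorem mul_smul' (c : ℂ) (a b : TwistedGroupAlgebra f) : a * (c • b) = c • (a * b) := by
  simp [mul_def]

theorem induction_basis {p : TwistedGroupAlgebra f → Prop} (h0 : p 0)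
    (hadd : ∀ a b, p a → p b → p (a + b)) (hsmul : ∀ (c : ℂ) (a), p a → p (c • a))
    (hb : ∀ g, p (basis f g)) (a : TwistedGroupAlgebra f) : p a := by
  refine Submodule.span_induction (p := fun a _ => p a) ?_ h0 (fun a b _ _ => hadd a b)
    (fun c a _ => hsmul c a) ((basis f).mem_span a)
  rintro _ ⟨g, rfl⟩
  exact hb g

theorem add_mul' (a b c : TwistedGroupAlgebra f) : (a + b) * c = a * c + b * c := by
  simp [mul_def]

theorem mul_add' (a b c : TwistedGroupAlgebra f) : a * (b + c) = a * b + a * c := by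
  simp [mul_def]

theorem zero_mul' (a : TwistedGroupAlgebra f) : 0 * a = 0 := by
  simp [mul_def]

theorem mul_zero' (a : TwistedGroupAlgebra f) : a * 0 = 0 := by
  simp [mul_def]

theorem mul_assoc' (a b c : TwistedGroupAlgebra f) : a * b * c = a * (b * c) := by
  induction a using induction_basis with
  | h0 => simp only [zero_mul']
  | hadd a b ha hb => simp only [add_mul', ha, hb]
  | hsmul r a ha => simp only [smul_mul', ha]
  | hb x =>
    induction b using induction_basis with
    | h0 => simp only [zero_mul', mul_zero']
    | hadd a b ha hb => simp only [add_mul', mul_add', ha, hb]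
    | hsmul r a ha => simp only [smul_mul', mul_smul', ha]
    | hb y =>
      induction c using induction_basis with
      | h0 => simp only [mul_zero']
      | hadd a b ha hb => simp only [mul_add', ha, hb]
      | hsmul r a ha => simp only [mul_smul', ha]
      | hb z =>
        rw [basis_mul_basis, basis_mul_basis, smul_mul', mul_smul', basis_mul_basis,
          basis_mul_basis, smul_smul, smul_smul, mul_assoc x y z]
        congr 1
        exact_mod_cast f.cocycle x y z

theorem one_mul' (a : TwistedGroupAlgebra f) : 1 * a = a := by
  have h : mulBilin f 1 = LinearMap.id := by
    refine (basis f).ext fun x => ?_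
    change 1 * basis f x = basis f x
    rw [one_def, smul_mul', basis_mul_basis, smul_smul, f.one_left x, one_mul,
      inv_mul_cancel₀ (Units.ne_zero _), one_smul]
  exact LinearMap.congr_fun h a

theorem mul_one' (a : TwistedGroupAlgebra f) : a * 1 = a := by
  have h : (mulBilin f).flip 1 = LinearMap.id := by
    refine (basis f).ext fun x => ?_
    change basis f x * 1 = basis f x
    rw [one_def, mul_smul', basis_mul_basis, smul_smul, f.one_right x, mul_one,
      inv_mul_cancel₀ (Units.ne_zero _), one_smul]
  exact LinearMap.congr_fun h a

noncomputable instance : Ring (TwistedGroupAlgebra f) where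
  __ := (inferInstance : AddCommGroup (TwistedGroupAlgebra f))
  mul a b := a * b
  one := 1
  left_distrib a b c := by simp [mul_def]
  right_distrib a b c := by simp [mul_def]
  zero_mul a := by simp [mul_def]
  mul_zero a := by simp [mul_def]
  mul_assoc := mul_assoc' f
  one_mul := one_mul' f
  mul_one := mul_one' f

noncomputable instance : Algebra ℂ (TwistedGroupAlgebra f) :=
  Algebra.ofModule (smul_mul' f) (mul_smul' f)

/-- The basis element `u_g` as an invertible element of `ℂ^f G`. -/
noncomputable def u (g : G) : (TwistedGroupAlgebra f)ˣ where
  val := basis f g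
  inv := (((f 1 1 * f g g⁻¹ : ℂˣ) : ℂ))⁻¹ • basis f g⁻¹
  val_inv := by
    rw [mul_smul', basis_mul_basis, smul_smul, mul_inv_cancel, one_def]
    have h1 := (f 1 1).ne_zero
    have h2 := (f g g⁻¹).ne_zero
    congr 1
    push_cast
    field_simp
  inv_val := by
    have h := f.cocycle g g⁻¹ g
    rw [mul_inv_cancel, inv_mul_cancel, f.one_left g, f.one_right g, mul_comm] at h
    rw [smul_mul', basis_mul_basis, smul_smul, inv_mul_cancel, one_def]
    have h' : f g g⁻¹ = f g⁻¹ g := mul_right_cancel (by rw [mul_comm, h])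
    congr 1
    rw [h']
    have h1 := (f 1 1).ne_zero
    have h2 := (f g⁻¹ g).ne_zero
    push_cast
    field_simp

/-- The action of `G` on `ℂ^f G` by algebra automorphisms, `g(a) = u_g a u_g⁻¹`. -/
noncomputable def conjAction :
    G →* (TwistedGroupAlgebra f ≃ₐ[ℂ] TwistedGroupAlgebra f) where
  toFun g := AlgEquiv.ofLinearEquiv
    { toFun := fun a => u f g * a * ↑(u f g)⁻¹
      invFun := fun a => ↑(u f g)⁻¹ * a * u f g
      map_add' := fun a b => by rw [mul_add, add_mul]
      map_smul' := fun c a => by simp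
      left_inv := fun a => by simp [mul_assoc]
      right_inv := fun a => by simp [mul_assoc] }
    (by simp) (fun a b => by simp [mul_assoc])
  map_one' := by
    ext a
    change (u f 1 : TwistedGroupAlgebra f) * a * ↑(u f 1)⁻¹ = a
    have h : (u f 1 : TwistedGroupAlgebra f) = ((f 1 1 : ℂˣ) : ℂ) • 1 := by
      change basis f 1 = _
      rw [one_def, smul_smul]
      simp
    rw [Units.mul_inv_eq_iff_eq_mul, h]
    simp
  map_mul' g h := by
    ext a
    change (u f (g * h) : TwistedGroupAlgebra f) * a * ↑(u f (g * h))⁻¹ =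
      u f g * (u f h * a * ↑(u f h)⁻¹) * ↑(u f g)⁻¹
    have hm : (u f (g * h) : TwistedGroupAlgebra f) =
        ((f g h : ℂˣ) : ℂ)⁻¹ • (u f g * u f h : TwistedGroupAlgebra f) := by
      change basis f (g * h) = _ • (basis f g * basis f h)
      rw [basis_mul_basis, smul_smul]
      simp
    rw [Units.mul_inv_eq_iff_eq_mul, hm]
    simp [mul_assoc]

@[simp]
theorem conjAction_apply (g : G) (a : TwistedGroupAlgebra f) :
    conjAction f g a = u f g * a * ↑(u f g)⁻¹ := rfl

end TwistedGroupAlgebra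

section SemiCenter

variable {G K A : Type*} [Group G] [Field K] [Ring A] [Algebra K A]

/-- For a group `G` acting on a `K`-algebra `A` by algebra automorphisms: a nonzero element `a`
is semi-invariant if `g(a) = χ(g) a` for all `g`, for some `χ ∈ Hom(G, Kˣ)` (its weight). -/
def IsSemiInvariant (ρ : G →* (A ≃ₐ[K] A)) (a : A) : Prop :=
  a ≠ 0 ∧ ∃ χ : G →* Kˣ, ∀ g : G, ρ g a = ((χ g : Kˣ) : K) • a

/-- The semi-center `Sz(A)`: the linear span of the semi-invariant elements, which is a
subalgebra of `A`. -/
def semiCenter (ρ : G →* (A ≃ₐ[K] A)) : Subalgebra K A :=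
  (Submodule.span K {a : A | IsSemiInvariant ρ a}).toSubalgebra
    (by
      by_cases h : (1 : A) = 0
      · rw [h]; exact Submodule.zero_mem _
      · exact Submodule.subset_span ⟨h, 1, fun g => by simp⟩)
    (by
      intro a b ha hb
      refine Submodule.span_induction₂ (p := fun a b _ _ =>
        a * b ∈ Submodule.span K {a : A | IsSemiInvariant ρ a}) ?_ ?_ ?_ ?_ ?_ ?_ ?_ ha hb
      · rintro x y ⟨-, χ, hx⟩ ⟨-, ψ, hy⟩
        by_cases h : x * y = 0
        · rw [h]; exact Submodule.zero_mem _
        · refine Submodule.subset_span ⟨h, χ * ψ, fun g => ?_⟩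
          rw [map_mul, hx, hy, smul_mul_smul_comm, MonoidHom.mul_apply, Units.val_mul]
      · intro y _; rw [zero_mul]; exact Submodule.zero_mem _
      · intro x _; rw [mul_zero]; exact Submodule.zero_mem _
      · intro x y z _ _ _ h1 h2; rw [add_mul]; exact Submodule.add_mem _ h1 h2
      · intro x y z _ _ _ h1 h2; rw [mul_add]; exact Submodule.add_mem _ h1 h2
      · intro r x y _ _ h; rw [smul_mul_assoc]; exact Submodule.smul_mem _ r h
      · intro r x y _ _ h; rw [mul_smul_comm]; exact Submodule.smul_mem _ r h)

end SemiCenter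

/-- A 2-cocycle `f` is nondegenerate if the twisted group algebra `ℂ^f G` is simple. -/
def TwoCocycle.Nondegenerate {G : Type*} [Group G] (f : TwoCocycle G) : Prop :=
  IsSimpleRing (TwistedGroupAlgebra f)

/-- A Hall subgroup of a finite group: its order is coprime to its index. -/
def Subgroup.IsHallSubgroup {G : Type*} [Group G] (H : Subgroup G) : Prop :=
  (Nat.card H).Coprime H.index

/-! Write `A` for the twisted group algebra and `H` for the commutator subgroup. Averaging over the
characters of the abelianization shows that the semi-center is the fixed algebra of `H`
(`mem_semiCenter_iff`), that is, the centralizer of the `u_h`, `h ∈ H`. When these span a central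
simple algebra, `A` is its tensor product with the centralizer, so ideals of the centralizer extend
to `A`.

This is carried out by hand. Simplicity forces every nontrivial element to be non-regular
(`noRegularElements`), and only that combinatorial condition on `H` is used afterwards. It makes the
sum `conjSum` of `H`-conjugates kill `u_h` for `h ≠ 1`, hence act like a trace on the span of the
`u_h`. This trace recovers `A` as the span of fixed elements times the `u_h`
(`sum_conjSum_mul_basis`) and lifts a nonzero ideal of the fixed algebra to a nonzero ideal of `A`
(`isSimpleRing_of_mem_iff_fixed`).

In the Hall case the condition passes from the whole group to `H` by coprimality
(`noRegularElements_restrict`). -/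

/-- An element `h` is `f`-regular if `f x h = f h x` for all `x` commuting with `h`. This says
that `1` is the only `f`-regular element. -/
def TwoCocycle.NoRegularElements {G : Type*} [Group G] (f : TwoCocycle G) : Prop :=
  ∀ h : G, h ≠ 1 → ∃ x, Commute x h ∧ f x h ≠ f h x

/-- For `c` in the spectrum of `s`, the element `c - s` is central and not invertible, while the
center of a simple ring is a field; so `c - s = 0`. -/
theorem IsSimpleRing.exists_eq_smul_one_of_commute {K A : Type*} [Field K] [IsAlgClosed K]
    [Ring A] [Algebra K A] [FiniteDimensional K A] [IsSimpleRing A] (s : A)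
    (hs : ∀ a, a * s = s * a) : ∃ c : K, s = c • (1 : A) := by
  obtain ⟨c, hc⟩ := spectrum.nonempty_of_isAlgClosed_of_finiteDimensional K s
  refine ⟨c, ?_⟩
  by_contra hne
  have hz : algebraMap K A c - s ∈ Subring.center A := by
    rw [Subring.mem_center_iff]
    intro a
    rw [mul_sub, sub_mul, hs a, Algebra.commutes]
  have hz0 : (⟨_, hz⟩ : Subring.center A) ≠ 0 := by
    intro h
    have h' : algebraMap K A c - s = 0 := congrArg Subtype.val h
    exact hne (by rw [← Algebra.algebraMap_eq_smul_one]; exact (sub_eq_zero.mp h').symm)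
  obtain ⟨w, hw⟩ := (IsSimpleRing.isField_center A).mul_inv_cancel hz0
  have hw' : (algebraMap K A c - s) * (w : A) = 1 := congrArg Subtype.val hw
  refine spectrum.mem_iff.mp hc ⟨⟨_, w, hw', ?_⟩, rfl⟩
  rw [← hw']
  exact (Subring.mem_center_iff.mp hz _)

/-! ### Regular elements and conjugation of the basis. -/

namespace TwistedGroupAlgebra

variable {G : Type*} [Group G] (f : TwoCocycle G)

instance [Finite G] : FiniteDimensional ℂ (TwistedGroupAlgebra f) :=
  Module.Finite.of_basis (basis f)

theorem coe_u (g : G) : (u f g : TwistedGroupAlgebra f) = basis f g := rfl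

theorem basis_one : basis f 1 = ((f 1 1 : ℂˣ) : ℂ) • (1 : TwistedGroupAlgebra f) := by
  rw [one_def, smul_smul, mul_inv_cancel₀ (Units.ne_zero _), one_smul]

theorem conjAction_basis (x h : G) :
    conjAction f x (basis f h) =
      ((f x h : ℂ) * (f (x * h * x⁻¹) x : ℂ)⁻¹) • basis f (x * h * x⁻¹) := by
  rw [conjAction_apply, Units.mul_inv_eq_iff_eq_mul, coe_u, basis_mul_basis, smul_mul_assoc,
    basis_mul_basis, smul_smul, inv_mul_cancel_right, mul_assoc,
    inv_mul_cancel₀ (Units.ne_zero _), mul_one]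

theorem conjAction_basis_of_commute {x h : G} (hx : Commute x h) :
    conjAction f x (basis f h) = ((f x h : ℂ) * (f h x : ℂ)⁻¹) • basis f h := by
  rw [conjAction_basis, hx.eq, mul_inv_cancel_right]

theorem conjAction_inv_apply (g : G) (a : TwistedGroupAlgebra f) :
    conjAction f g⁻¹ a = ↑(u f g)⁻¹ * a * u f g := by
  rw [map_inv]
  rfl

theorem coe_inv_u (g : G) : ∃ c : ℂ, (↑(u f g)⁻¹ : TwistedGroupAlgebra f) = c • basis f g⁻¹ :=
  ⟨_, rfl⟩

/-- If `h ≠ 1` were regular, the sum of all conjugates of `u_h` would be central, hence scalar, with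
coefficient `0` at `h`. But regularity makes that coefficient the order of the centralizer of `h`.
-/
theorem noRegularElements [Finite G] (hf : IsSimpleRing (TwistedGroupAlgebra f)) :
    f.NoRegularElements := by
  classical
  intro h h1
  by_contra! hreg
  have := Fintype.ofFinite G
  set s := ∑ g : G, conjAction f g (basis f h) with hs
  have hfix : ∀ k, conjAction f k s = s := by
    intro k
    rw [hs, map_sum]
    exact Fintype.sum_equiv (Equiv.mulLeft k) _ _ fun g => by simp only [Equiv.coe_mulLeft,
      map_mul, AlgEquiv.mul_apply]
  have hcomm : ∀ a, a * s = s * a := by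
    intro a
    induction a using induction_basis with
    | h0 => simp
    | hadd a b ha hb => rw [add_mul, mul_add, ha, hb]
    | hsmul c a ha => rw [smul_mul_assoc, mul_smul_comm, ha]
    | hb g =>
      have := hfix g
      rwa [conjAction_apply, Units.mul_inv_eq_iff_eq_mul] at this
  obtain ⟨c, hc⟩ := IsSimpleRing.exists_eq_smul_one_of_commute (K := ℂ) s hcomm
  have hl : (basis f).repr s h = 0 := by
    rw [hc, one_def]
    simp [h1.symm]
  have hr : (basis f).repr s h = ((Finset.univ.filter fun g : G => Commute g h).card : ℂ) := by
    rw [hs, map_sum, Finsupp.finsetSum_apply, Finset.card_filter, Nat.cast_sum]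
    refine Finset.sum_congr rfl fun g _ => ?_
    split_ifs with hg
    · rw [conjAction_basis_of_commute f hg, hreg g hg, mul_inv_cancel₀ (Units.ne_zero _)]
      simp
    · have : g * h * g⁻¹ ≠ h := fun e => hg (mul_inv_eq_iff_eq_mul.mp e)
      rw [conjAction_basis]
      simp [this]
  rw [hr, Nat.cast_eq_zero, Finset.card_eq_zero] at hl
  have : (1 : G) ∈ Finset.univ.filter fun g : G => Commute g h := by simp
  simp [hl] at this

/-- For a normal Hall subgroup, a regular element is regular in the whole group. -/
theorem noRegularElements_restrict (hf : f.NoRegularElements) (H : Subgroup G) [H.Normal]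
    (hH : H.IsHallSubgroup) : (f.restrict H).NoRegularElements := by
  intro h h1
  by_contra! hreg
  obtain ⟨x, hx, hne⟩ := hf h (by simpa using h1)
  have key : ∀ {x : G}, Commute x h → conjAction f x (basis f h) = basis f h →
      f x h = f h x := by
    intro x hx e
    rw [conjAction_basis_of_commute f hx] at e
    have e1 := congrArg (fun a => (basis f).repr a (h : G)) e
    simp only [map_smul, Module.Basis.repr_self, Finsupp.smul_apply, Finsupp.single_eq_same,
      smul_eq_mul, mul_one] at e1
    exact Units.ext ((mul_inv_eq_one₀ (Units.ne_zero _)).mp e1)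
  refine hne (key hx ?_)
  -- Conjugation by `x` scales `u_h` by `r`; two coprime exponents will kill `r`.
  set r : ℂ := (f x h : ℂ) * (f h x : ℂ)⁻¹ with hr
  have hxr : conjAction f x (basis f (h : G)) = r • basis f (h : G) :=
    conjAction_basis_of_commute f hx
  have hpow : ∀ n : ℕ, conjAction f (x ^ n) (basis f (h : G)) = r ^ n • basis f (h : G) := by
    intro n
    induction n with
    | zero => simp
    | succ n ih => rw [pow_succ, map_mul, AlgEquiv.mul_apply, hxr, map_smul, ih, smul_smul,
        pow_succ, mul_comm]
  have hbne : basis f (h : G) ≠ 0 := (basis f).ne_zero _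
  -- The power `x ^ H.index` lies in `H`, where `h` is assumed regular.
  have hr1 : r ^ H.index = 1 := by
    have hmem : x ^ H.index ∈ H := H.pow_index_mem x
    have hc : Commute (x ^ H.index) (h : G) := hx.pow_left _
    have e := hreg ⟨_, hmem⟩ (Subtype.ext hc.eq)
    have e' : f (x ^ H.index) h = f h (x ^ H.index) := e
    have h2 := hpow H.index
    rw [conjAction_basis_of_commute f hc, e', mul_inv_cancel₀ (Units.ne_zero _)] at h2
    exact (smul_left_injective ℂ hbne h2).symm
  -- The power `u_h ^ |H|` is a nonzero scalar, so conjugation by `x` fixes it.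
  have hr2 : r ^ Nat.card H = 1 := by
    have hpb : ∀ n : ℕ, ∃ c : ℂ, basis f (h : G) ^ n = c • basis f ((h : G) ^ n) := by
      intro n
      induction n with
      | zero => exact ⟨_, by rw [pow_zero, pow_zero, one_def]⟩
      | succ n ih =>
        obtain ⟨c, hc⟩ := ih
        exact ⟨_, by rw [pow_succ, hc, smul_mul_assoc, basis_mul_basis, smul_smul, ← pow_succ]⟩
    obtain ⟨c, hc⟩ := hpb (Nat.card H)
    have h3 : (h : G) ^ Nat.card H = 1 := by
      exact_mod_cast congrArg Subtype.val (pow_card_eq_one' (x := h))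
    rw [h3, basis_one, smul_smul] at hc
    have h4 := congrArg (conjAction f x) hc
    rw [map_pow, hxr, smul_pow, map_smul, map_one, ← hc] at h4
    have h5 : basis f (h : G) ^ Nat.card H ≠ 0 := by
      have : Nontrivial (TwistedGroupAlgebra f) := ⟨_, _, hbne⟩
      rw [← coe_u, ← Units.val_pow_eq_pow_val]
      exact Units.ne_zero _
    exact smul_left_injective ℂ h5 (h4.trans (one_smul ℂ _).symm)
  have hr3 : r = 1 := by
    have h6 := orderOf_dvd_of_pow_eq_one hr1
    have h7 := orderOf_dvd_of_pow_eq_one hr2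
    exact orderOf_eq_one_iff.mp (Nat.dvd_one.mp (hH.gcd_eq_one ▸ Nat.dvd_gcd h7 h6))
  rw [hxr, hr3, one_smul]

/-! ### The trace onto the fixed points of a subgroup, and simplicity of the fixed algebra. -/

section FixedPoints

variable (H : Subgroup G) [Fintype H]

/-- The sum of the conjugates of an element under `u_h`, `h ∈ H`. -/
noncomputable def conjSum : TwistedGroupAlgebra f →ₗ[ℂ] TwistedGroupAlgebra f :=
  ∑ g : H, (conjAction f (g : G)).toLinearMap

theorem conjSum_apply (a : TwistedGroupAlgebra f) :
    conjSum f H a = ∑ g : H, conjAction f (g : G) a := by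
  simp [conjSum, LinearMap.sum_apply]

theorem conjAction_conjSum (k : H) (a : TwistedGroupAlgebra f) :
    conjAction f (k : G) (conjSum f H a) = conjSum f H a := by
  rw [conjSum_apply, map_sum]
  exact Fintype.sum_equiv (Equiv.mulLeft k) _ _ fun g => by simp only [Equiv.coe_mulLeft,
    Subgroup.coe_mul, map_mul, AlgEquiv.mul_apply]

theorem conjSum_conjAction (k : H) (a : TwistedGroupAlgebra f) :
    conjSum f H (conjAction f (k : G) a) = conjSum f H a := by
  rw [conjSum_apply, conjSum_apply]
  exact Fintype.sum_equiv (Equiv.mulRight k) _ _ fun g => by simp only [Equiv.coe_mulRight,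
    Subgroup.coe_mul, map_mul, AlgEquiv.mul_apply]

/-- The trace property: the two arguments are conjugate under `u_k`. -/
theorem conjSum_mul_basis (k : H) (a : TwistedGroupAlgebra f) :
    conjSum f H (a * basis f (k : G)) = conjSum f H (basis f (k : G) * a) := by
  rw [← conjSum_conjAction f H k (a * basis f (k : G)), conjAction_apply, ← coe_u]
  simp [mul_assoc]

theorem conjSum_of_fixed {s : TwistedGroupAlgebra f} (hs : ∀ g : H, conjAction f (g : G) s = s) :
    conjSum f H s = (Fintype.card H : ℂ) • s := by
  rw [conjSum_apply, Finset.sum_congr rfl fun g _ => hs g]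
  simp [Nat.cast_smul_eq_nsmul]

theorem conjSum_fixed_mul {s : TwistedGroupAlgebra f}
    (hs : ∀ g : H, conjAction f (g : G) s = s) (a : TwistedGroupAlgebra f) :
    conjSum f H (s * a) = s * conjSum f H a := by
  simp only [conjSum_apply, map_mul, hs, Finset.mul_sum]

theorem conjSum_mul_fixed {s : TwistedGroupAlgebra f}
    (hs : ∀ g : H, conjAction f (g : G) s = s) (a : TwistedGroupAlgebra f) :
    conjSum f H (a * s) = conjSum f H a * s := by
  simp only [conjSum_apply, map_mul, hs, Finset.sum_mul]

variable {H} in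
-- A witness `x` of non-regularity multiplies `u_h` by a scalar other than `1` without changing its
-- trace.
theorem conjSum_basis_eq_zero (hH : (f.restrict H).NoRegularElements) {h : H} (h1 : h ≠ 1) :
    conjSum f H (basis f (h : G)) = 0 := by
  obtain ⟨x, hx, hne⟩ := hH h h1
  have hx' : Commute (x : G) (h : G) := congrArg Subtype.val hx.eq
  have hne' : f (x : G) (h : G) ≠ f (h : G) (x : G) := hne
  have e := conjSum_conjAction f H x (basis f (h : G))
  rw [conjAction_basis_of_commute f hx', map_smul] at e
  by_contra h0
  have e1 := smul_left_injective ℂ h0 (e.trans (one_smul ℂ _).symm)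
  exact hne' (Units.ext ((mul_inv_eq_one₀ (Units.ne_zero _)).mp e1))

variable {H} in
theorem exists_conjSum_basis_eq (hH : (f.restrict H).NoRegularElements) (h : H) :
    ∃ c : ℂ, conjSum f H (basis f (h : G)) = c • 1 := by
  by_cases h1 : h = 1
  · subst h1
    rw [Subgroup.coe_one, basis_one, map_smul, conjSum_of_fixed f H (s := 1) (by simp), smul_smul]
    exact ⟨_, rfl⟩
  · exact ⟨0, by rw [conjSum_basis_eq_zero f hH h1, zero_smul]⟩

variable {H} in
/-- The twisted group algebra is spanned by products of elements fixed by `H` with the `u_h`,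
`h ∈ H`. -/
theorem sum_conjSum_mul_basis (hH : (f.restrict H).NoRegularElements)
    (x : TwistedGroupAlgebra f) :
    ∑ g : H, conjSum f H (x * ↑(u f (g : G))⁻¹) * basis f (g : G) = (Fintype.card H : ℂ) • x := by
  -- Regrouping `u_h x u_g⁻¹ u_h⁻¹ u_g` turns the last three factors into a conjugate of `u_h⁻¹`, so
  -- summing over `g` gives a trace that vanishes unless `h = 1`.
  have h1 : ∀ g h : H, conjAction f (h : G) (x * ↑(u f (g : G))⁻¹) * basis f (g : G) =
      u f (h : G) * x * conjAction f ((g⁻¹ : H) : G) ↑(u f (h : G))⁻¹ := by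
    intro g h
    rw [Subgroup.coe_inv, conjAction_inv_apply, conjAction_apply, ← coe_u]
    simp only [mul_assoc]
  simp only [conjSum_apply, Finset.sum_mul, h1]
  rw [Finset.sum_comm]
  simp only [← Finset.mul_sum]
  have h2 : ∀ h : H, ∑ g : H, conjAction f ((g⁻¹ : H) : G) ↑(u f (h : G))⁻¹ =
      conjSum f H ↑(u f (h : G))⁻¹ := by
    intro h
    rw [conjSum_apply, ← Equiv.sum_comp (Equiv.inv H)]
    simp
  simp only [h2]
  rw [Finset.sum_eq_single (1 : H)]
  · obtain ⟨c, hc⟩ := coe_inv_u f (1 : G)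
    have h3 := conjAction_apply f 1 x
    rw [map_one, AlgEquiv.one_apply] at h3
    rw [Subgroup.coe_one, conjSum_of_fixed, mul_smul_comm, ← h3]
    intro g
    rw [hc, inv_one, basis_one]
    simp
  · intro h _ hh
    obtain ⟨c, hc⟩ := coe_inv_u f (h : G)
    have := conjSum_basis_eq_zero f hH (h := h⁻¹) (by simpa using hh)
    rw [Subgroup.coe_inv] at this
    rw [hc, map_smul, this, smul_zero, mul_zero]
  · simp

variable {H} in
/-- If `H` has no nontrivial regular elements, the fixed points of `H` in a simple twisted group
algebra form a simple algebra. -/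
theorem isSimpleRing_of_mem_iff_fixed [IsSimpleRing (TwistedGroupAlgebra f)]
    (hH : (f.restrict H).NoRegularElements) (S : Subalgebra ℂ (TwistedGroupAlgebra f))
    (hS : ∀ a, a ∈ S ↔ ∀ g : H, conjAction f (g : G) a = a) : IsSimpleRing S := by
  refine IsSimpleRing.of_eq_bot_or_eq_top fun I => or_iff_not_imp_left.mpr fun hI => ?_
  have hcard : (Fintype.card H : ℂ) ≠ 0 := Nat.cast_ne_zero.mpr Fintype.card_ne_zero
  let P : TwistedGroupAlgebra f →ₗ[ℂ] S :=
    (conjSum f H).codRestrict (Subalgebra.toSubmodule S)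
      fun a => (hS _).mpr fun g => conjAction_conjSum f H g a
  have hP : ∀ a, (P a : TwistedGroupAlgebra f) = conjSum f H a := fun a => rfl
  have hIs : ∀ (c : ℂ) {s : S}, s ∈ I → c • s ∈ I := fun c s hs => by
    rw [← smul_one_mul c s]
    exact I.mul_mem_left _ _ hs
  have hPl : ∀ (s : S) (a), P (s * a) = s * P a := fun s a =>
    Subtype.ext (conjSum_fixed_mul f H ((hS _).mp s.2) a)
  have hPr : ∀ (s : S) (a), P (a * s) = P a * s := fun s a =>
    Subtype.ext (conjSum_mul_fixed f H ((hS _).mp s.2) a)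
  have hPc : ∀ (k : H) (a), P (a * basis f (k : G)) = P (basis f (k : G) * a) := fun k a =>
    Subtype.ext (conjSum_mul_basis f H k a)
  have hsb : ∀ (k : H) (s : S), (s : TwistedGroupAlgebra f) * basis f (k : G) =
      basis f (k : G) * s := by
    intro k s
    have := (hS _).mp s.2 k
    rw [conjAction_apply, Units.mul_inv_eq_iff_eq_mul] at this
    exact this.symm
  -- The elements all of whose coordinates in the decomposition `hdec` lie in `I`: this will be the
  -- two-sided ideal of the whole algebra generated by `I`.
  let W : Submodule ℂ (TwistedGroupAlgebra f) :=
    { carrier := {a | ∀ h : H, P (a * basis f (h : G)) ∈ I}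
      zero_mem' := fun h => by rw [zero_mul, map_zero]; exact I.zero_mem
      add_mem' := fun ha hb h => by rw [add_mul, map_add]; exact I.add_mem (ha h) (hb h)
      smul_mem' := fun c a ha h => by rw [smul_mul_assoc, map_smul]; exact hIs c (ha h) }
  have hW : ∀ a, a ∈ W ↔ ∀ h : H, P (a * basis f (h : G)) ∈ I := fun a => Iff.rfl
  have hdec : ∀ a, a = (Fintype.card H : ℂ)⁻¹ • ∑ g : H,
      (P (a * ↑(u f (g : G))⁻¹) : TwistedGroupAlgebra f) * basis f (g : G) := fun a => by
    simp only [hP]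
    rw [sum_conjSum_mul_basis f hH, smul_smul, inv_mul_cancel₀ hcard, one_smul]
  have hWbr : ∀ (k : H) {a}, a ∈ W → a * basis f (k : G) ∈ W := fun k a ha h => by
    rw [mul_assoc, basis_mul_basis, mul_smul_comm, map_smul]
    exact hIs _ (ha (k * h))
  -- The trace property moves `u_k` from the left end to the right end.
  have hWbl : ∀ (k : H) {a}, a ∈ W → basis f (k : G) * a ∈ W := fun k a ha h => by
    rw [mul_assoc, ← hPc, mul_assoc, basis_mul_basis, mul_smul_comm, map_smul]
    exact hIs _ (ha (h * k))
  have hWsl : ∀ (s : S) {a}, a ∈ W → s * a ∈ W := fun s a ha h => by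
    rw [mul_assoc, hPl]
    exact I.mul_mem_left _ _ (ha h)
  have hWsr : ∀ (s : S) {a}, a ∈ W → a * s ∈ W := fun s a ha h => by
    rw [mul_assoc, hsb, ← mul_assoc, hPr]
    exact I.mul_mem_right _ _ (ha h)
  have hWl : ∀ b {a}, a ∈ W → b * a ∈ W := fun b a ha => by
    rw [hdec b, smul_mul_assoc, Finset.sum_mul]
    refine W.smul_mem _ (W.sum_mem fun g _ => ?_)
    rw [mul_assoc]
    exact hWsl _ (hWbl g ha)
  have hWr : ∀ b {a}, a ∈ W → a * b ∈ W := fun b a ha => by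
    rw [hdec b, mul_smul_comm, Finset.mul_sum]
    refine W.smul_mem _ (W.sum_mem fun g _ => ?_)
    rw [← mul_assoc]
    exact hWbr g (hWsr _ ha)
  let J : TwoSidedIdeal (TwistedGroupAlgebra f) := .mk' W W.zero_mem W.add_mem W.neg_mem
    (hWl _) (hWr _)
  have hJ : ∀ a, a ∈ J ↔ a ∈ W := fun a => TwoSidedIdeal.mem_mk' ..
  obtain ⟨i, hiI, hi0⟩ := SetLike.exists_of_lt (bot_lt_iff_ne_bot.mpr hI)
  -- Elements of `I` lie in `W`, since `P (i * u_h) = i * P u_h` and `P u_h` is scalar.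
  have hiJ : (i : TwistedGroupAlgebra f) ∈ J := by
    rw [hJ, hW]
    intro h
    obtain ⟨c, hc⟩ := exists_conjSum_basis_eq f hH h
    have hc' : P (basis f (h : G)) = c • 1 := Subtype.ext hc
    rw [hPl, hc', mul_smul_comm, mul_one]
    exact hIs c hiI
  have h1J : (1 : TwistedGroupAlgebra f) ∈ J :=
    IsSimpleRing.one_mem_of_ne_zero_mem J (fun h => hi0 (Subtype.ext h)) hiJ
  -- Now `1 ∈ W`, so `I` contains `P u_1`, a nonzero scalar.
  have h1 := (hW _).mp ((hJ _).mp h1J) 1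
  have h2 : P (1 * basis f ((1 : H) : G)) = ((f 1 1 : ℂ) * Fintype.card H) • (1 : S) := by
    refine Subtype.ext ?_
    rw [hP, one_mul, Subgroup.coe_one, basis_one, map_smul, conjSum_of_fixed f H (by simp),
      smul_smul]
    rfl
  rw [h2] at h1
  have h3 := hIs ((f 1 1 : ℂ) * Fintype.card H)⁻¹ h1
  rw [smul_smul, inv_mul_cancel₀ (mul_ne_zero (Units.ne_zero _) hcard), one_smul] at h3
  exact I.one_mem_iff.mp h3

end FixedPoints

end TwistedGroupAlgebra

/-! ### The semi-center as a fixed algebra, by character averaging. -/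

section Characters

variable {G A : Type*} [Group G] [Finite G] [Ring A] [Algebra ℂ A]

/-- The semi-center is the subalgebra of fixed points of the commutator subgroup. -/
theorem mem_semiCenter_iff (ρ : G →* (A ≃ₐ[ℂ] A)) (a : A) :
    a ∈ semiCenter ρ ↔ ∀ g : commutator G, ρ (g : G) a = a := by
  classical
  constructor
  · intro ha g
    have ha' : a ∈ Submodule.span ℂ {a : A | IsSemiInvariant ρ a} := ha
    induction ha' using Submodule.span_induction with
    | zero => simp
    | add x y hx hy h1 h2 => rw [map_add, h1 hx, h2 hy]
    | smul c x hx h => rw [map_smul, h hx]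
    | mem x hx =>
      obtain ⟨-, χ, hχ⟩ := hx
      have : χ (g : G) = 1 := Abelianization.commutator_subset_ker χ g.2
      rw [hχ, this, Units.val_one, one_smul]
  · intro ha
    have := Fintype.ofFinite G
    obtain ⟨e⟩ := CommGroup.monoidHom_mulEquiv_of_hasEnoughRootsOfUnity (Abelianization G) ℂ
    have : Finite (Abelianization G →* ℂˣ) := Finite.of_equiv _ e.symm.toEquiv
    have := Fintype.ofFinite (Abelianization G →* ℂˣ)
    -- The projection of `a` to weight `χ`, up to a factor, is semi-invariant or zero.
    have hmem : ∀ χ : G →* ℂˣ, ∑ g : G, ((χ g)⁻¹ : ℂˣ) • ρ g a ∈ semiCenter ρ := by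
      intro χ
      by_cases h0 : ∑ g : G, ((χ g)⁻¹ : ℂˣ) • ρ g a = 0
      · rw [h0]
        exact zero_mem _
      · refine Submodule.subset_span ⟨h0, χ, fun k => ?_⟩
        rw [map_sum, Finset.smul_sum,
          ← Equiv.sum_comp (Equiv.mulLeft k) fun g => ((χ k : ℂˣ) : ℂ) • ((χ g)⁻¹ : ℂˣ) • ρ g a]
        refine Finset.sum_congr rfl fun g _ => ?_
        simp only [Units.smul_def, Equiv.coe_mulLeft, map_mul, map_smul, AlgEquiv.mul_apply,
          smul_smul]
        congr 1
        rw [← Units.val_mul]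
        congr 1
        rw [mul_inv, mul_inv_cancel_left]
    have hsum : ∀ g : Abelianization G, g ≠ 1 →
        ∑ χ : Abelianization G →* ℂˣ, (((χ g)⁻¹ : ℂˣ) : ℂ) = 0 := by
      intro g hg
      obtain ⟨ψ, hψ⟩ := CommGroup.exists_apply_ne_one_of_hasEnoughRootsOfUnity _ ℂ hg
      have h1 : ∑ χ : Abelianization G →* ℂˣ, (((χ g)⁻¹ : ℂˣ) : ℂ) =
          (((ψ g)⁻¹ : ℂˣ) : ℂ) * ∑ χ : Abelianization G →* ℂˣ, (((χ g)⁻¹ : ℂˣ) : ℂ) := by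
        rw [Finset.mul_sum, ← Equiv.sum_comp (Equiv.mulLeft ψ)]
        simp [mul_comm]
      by_contra h0
      have h2 := (mul_eq_right₀ h0).mp h1.symm
      exact hψ (inv_eq_one.mp (Units.ext h2))
    -- By orthogonality only the `g` in the commutator subgroup survive, and these fix `a`.
    have htot : ∑ χ : Abelianization G →* ℂˣ, ∑ g : G,
        ((χ.comp Abelianization.of g)⁻¹ : ℂˣ) • ρ g a =
        ((Fintype.card (Abelianization G →* ℂˣ) : ℂ) *
          (Finset.univ.filter fun g : G => g ∈ commutator G).card) • a := by
      rw [Finset.sum_comm]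
      simp only [Units.smul_def, ← Finset.sum_smul, MonoidHom.comp_apply]
      rw [mul_comm, mul_smul, Nat.cast_smul_eq_nsmul, ← Finset.sum_const, Finset.sum_filter]
      refine Finset.sum_congr rfl fun g _ => ?_
      split_ifs with hg
      · have h1 : Abelianization.of g = 1 := by
          rw [← MonoidHom.mem_ker, Abelianization.ker_of]
          exact hg
        rw [ha ⟨g, hg⟩, h1]
        simp
      · rw [hsum, zero_smul]
        intro h1
        rw [← MonoidHom.mem_ker, Abelianization.ker_of] at h1
        exact hg h1
    have hne : ((Fintype.card (Abelianization G →* ℂˣ) : ℂ) *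
        (Finset.univ.filter fun g : G => g ∈ commutator G).card) ≠ 0 := by
      refine mul_ne_zero (Nat.cast_ne_zero.mpr Fintype.card_ne_zero) (Nat.cast_ne_zero.mpr ?_)
      exact Finset.card_ne_zero_of_mem (a := 1) (by simp [one_mem])
    have h := Subalgebra.smul_mem (semiCenter ρ)
      (sum_mem fun (χ : Abelianization G →* ℂˣ) (_ : χ ∈ Finset.univ) =>
        hmem (χ.comp Abelianization.of)) ((Fintype.card (Abelianization G →* ℂˣ) : ℂ) *
          (Finset.univ.filter fun g : G => g ∈ commutator G).card)⁻¹
    rw [htot, smul_smul, inv_mul_cancel₀ hne, one_smul] at h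
    exact h

end Characters

theorem theorem3 {G : Type*} [Group G] [Finite G] (f : TwoCocycle G)
    (hf : IsSimpleRing (TwistedGroupAlgebra f)) :
    ((f.restrict (commutator G)).Nondegenerate →
      IsSimpleRing (semiCenter (TwistedGroupAlgebra.conjAction f))) ∧
    ((commutator G).IsHallSubgroup →
      IsSimpleRing (semiCenter (TwistedGroupAlgebra.conjAction f))) := by
  have := Fintype.ofFinite (commutator G)
  have key : (f.restrict (commutator G)).NoRegularElements →
      IsSimpleRing (semiCenter (TwistedGroupAlgebra.conjAction f)) := fun h =>
    TwistedGroupAlgebra.isSimpleRing_of_mem_iff_fixed f h _ (mem_semiCenter_iff _)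
  exact ⟨fun h => key (TwistedGroupAlgebra.noRegularElements _ h), fun h =>
    key (TwistedGroupAlgebra.noRegularElements_restrict f
      (TwistedGroupAlgebra.noRegularElements f hf) _ h)⟩
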